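/- Let $(X,d)$ be a finite metric space with $n=|X|$ points and let $k,z\ge 1$ be integers with $k\le n$. For a nonempty set of centers $C\subseteq X$ let $d(x,C)=\min_{c\in C}d(x,c)$ and $\phi_C(X,d)=\bigl(\sum_{x\in X}d(x,C)^z\bigr)^{1/z}$, and let $\phi_{\mathrm{OPT}}(X,d)$ be the minimum of $\phi_C(X,d)$ over all $C\subseteq X$ with $|C|=k$. A preference profile $P=\{\pi_x\}_{x\in X}$ consists of a bijection $\pi_x:\{1,\dots,n\}\to X$ for every $x\in X$; it is consistent with $d$ if $d(x,\pi_x(i))\le d(x,\pi_x(j))$ for all $x\in X$ and $i<j$. An algorithm for ordinal $(k,z)$-clustering is given $X$, $k$, $z$ and a profile $P$, but not $d$. It may toss coins and adaptively ask queries, each of which reveals the value $d(x,y)$ for two points $x,y\in X$ of its choice, and it returns a set of centers. **Theorem.** There are a randomized algorithm $\mathcal A$ for ordinal $(k,z)$-clustering and absolute constants $D$ and $K$ (independent of $n$, $k$, $z$, $d$ and $P$) such that for all integers $k,z\ge 1$, every finite metric space $(X,d)$ with $n=|X|\ge k$ points, and every preference profile $P$ consistent with $d$, the following holds. The algorithm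 returns a set $\mathcal A(P,d)\subseteq X$ of exactly $k$ centers, it makes at most $K\,k^4\log^5 n$ distance queries for all outcomes of its random choices, and its expected distortion is $O(1)$, that is, $$\mathbb E\bigl[\phi_{\mathcal A(P,d)}(X,d)\bigr]\le D\cdot \phi_{\mathrm{OPT}}(X,d).$$ -/

import Mathlib

universe u v

namespace OrdinalClustering

/-- A randomized, adaptive query algorithm on the point set `X` with results in `α`.
At every moment it stops with a result, or queries the distance of two points and continues
depending on the real number it gets, or draws one of finitely many alternatives from a
probability distribution of its choice (which may depend on all that it has seen so far). -/
inductive QueryTree (X : Type u) (α : Type v) : Type (max u v)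
  | output (a : α) : QueryTree X α
  | query (x y : X) (next : ℝ → QueryTree X α) : QueryTree X α
  | draw (m : ℕ) (p : PMF (Fin m)) (next : Fin m → QueryTree X α) : QueryTree X α

namespace QueryTree

variable {X : Type u} {α : Type v}

/-- The distribution of the result when queries are answered according to `d`. -/
noncomputable def result (d : X → X → ℝ) : QueryTree X α → PMF α
  | output a => PMF.pure a
  | query x y next => result d (next (d x y))
  | draw _ p next => p.bind fun i => result d (next i)

/-- The worst case, over all random choices, of the number of queries that are made when
queries are answered according to `d`. -/
def queries (d : X → X → ℝ) : QueryTree X α → ℕ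
  | output _ => 0
  | query x y next => queries d (next (d x y)) + 1
  | draw _ _ next => Finset.univ.sup fun i => queries d (next i)

end QueryTree

/-- A preference profile: every point `x` reports a ranking `P x` of all `n` points, where
`P x i` is the point at position `i`. -/
abbrev Profile (X : Type u) [Fintype X] : Type u := X → (Fin (Fintype.card X) ≃ X)

/-- The profile agrees with the metric: the points appear in the ranking of `x` in order of
nondecreasing distance from `x` (ties are broken arbitrarily). -/
def Profile.Consistent {X : Type u} [Fintype X] [MetricSpace X] (P : Profile X) : Prop :=
  ∀ x : X, ∀ i j : Fin (Fintype.card X), i < j → dist x (P x i) ≤ dist x (P x j)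

/-- The cost of the set of centers `C` in `(k, z)`-clustering. For nonempty (finite) `C`,
`Metric.infDist x C` is the minimum of `dist x c` over `c ∈ C`. -/
noncomputable def cost {X : Type u} [Fintype X] [MetricSpace X] (z : ℕ) (C : Finset X) : ℝ :=
  (∑ x : X, Metric.infDist x (C : Set X) ^ z) ^ (1 / (z : ℝ))

/-- `C` is an optimal solution of `(k, z)`-clustering: `k` centers of minimal cost. -/
def IsOptimal {X : Type u} [Fintype X] [MetricSpace X] (k z : ℕ) (C : Finset X) : Prop :=
  C.card = k ∧ ∀ C' : Finset X, C'.card = k → cost z C ≤ cost z C'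

/-- The expected cost of a random set of centers. -/
noncomputable def expectedCost {X : Type u} [Fintype X] [MetricSpace X] (z : ℕ)
    (μ : PMF (Finset X)) : ℝ :=
  ∑ C : Finset X, (μ C).toReal * cost z C

/-- A randomized algorithm for ordinal `(k, z)`-clustering. Its input is the point set `X`, the
numbers `k` and `z`, and a preference profile; the metric is not part of the input and is
accessible through queries only. Its result is a set of centers. -/
abbrev ClusteringAlgorithm : Type (u + 1) :=
  ∀ (X : Type u) [Fintype X] (_k _z : ℕ), Profile X → QueryTree X (Finset X)

end OrdinalClustering

/-!
A deterministic algorithm suffices. Everything that the rankings determine is free: the trace of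
any ball on a set of points is the trace of a ranking prefix, and the ball of given center and
radius is found by binary search with `O(log |X|)` queries (`ensures_ballQuery`).

Farthest-point traversal needs `O(k ^ 2)` queries, because the point farthest from a set of centers
is the one that some center ranks last in its cell. It gives a number `R` such that `R / 2` is a
lower bound and `|X| * R` an upper bound for the optimal cost (`ensures_scaleQuery`), so only
`O(log |X|)` scales `r = 8 |X| R / 2 ^ j` matter.

At each scale `r` the algorithm repeatedly takes a net of the uncovered points, which meets every
ranking prefix that contains a `1 / (2 k)` fraction of them; as there are only `|X| ^ 2` prefixes,
greedy hitting gives a net of size `O(k log |X|)` (`exists_isNet`). If `O` is a set of `k` centers,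
the net meets each heavy cluster of points within `r / 2` of some `o ∈ O`, and then the balls of
radius `r` around the net cover this cluster, while the light clusters contain at most half of
the uncovered points. After logarithmically many rounds, the number of points at distance more than
`r` from the candidates is at most twice the number of points at distance more than `r / 2` from
`O` (`ensures_cover`). Summed over the scales by the layer-cake formula, this shows that the union
`B` of all candidates, a set of `O(k log ^ 3 |X|)` points, has cost `O(1)` times the optimum.

Some `k` of the candidates have cost `O(1)` times the optimum as well (`exists_snap`). The balls
around all candidates at all scales, which take `O(k log ^ 5 |X|)` queries, determine the cost of
each competitive set of candidates up to a constant factor and an error of order `R`. The algorithm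
returns `k` centers of least estimated cost (`isBest_spec`). In sums of `z`-th powers each constant
appears as `c ^ z`, which makes the distortion independent of `z`.
-/

universe w

namespace OrdinalClustering

open Finset
open scoped Classical

/-! ### Specifications of query algorithms -/

namespace QueryTree

variable {X : Type u} {α : Type v} {β : Type w} {d : X → X → ℝ}

/-- Sequential composition: run `T`, then the algorithm that `f` assigns to its result. -/
noncomputable def bind : QueryTree X α → (α → QueryTree X β) → QueryTree X β
  | output a, f => f a
  | query x y next, f => query x y fun v => (next v).bind f
  | draw m p next, f => draw m p fun i => (next i).bind f

/-- `Runs d T a m`: with queries answered by `d`, the algorithm `T` reaches the result `a` after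
exactly `m` queries and without tossing a coin. -/
inductive Runs (d : X → X → ℝ) : QueryTree X α → α → ℕ → Prop
  | output (a : α) : Runs d (output a) a 0
  | query {x y : X} {next : ℝ → QueryTree X α} {a : α} {m : ℕ}
      (h : Runs d (next (d x y)) a m) : Runs d (query x y next) a (m + 1)

theorem Runs.result_eq {T : QueryTree X α} {a : α} {m : ℕ} (h : Runs d T a m) :
    T.result d = PMF.pure a := by
  induction h with
  | output a => rfl
  | query h ih => simpa [QueryTree.result] using ih

theorem Runs.queries_eq {T : QueryTree X α} {a : α} {m : ℕ} (h : Runs d T a m) :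
    T.queries d = m := by
  induction h with
  | output a => rfl
  | query h ih => simpa [QueryTree.queries] using ih

theorem Runs.bind {T : QueryTree X α} {f : α → QueryTree X β} {a : α} {b : β} {m m' : ℕ}
    (h : Runs d T a m) (h' : Runs d (f a) b m') : Runs d (T.bind f) b (m + m') := by
  induction h with
  | output a => simpa [QueryTree.bind] using h'
  | query h ih =>
    rw [Nat.add_right_comm]
    exact Runs.query (ih h')

/-- A total-correctness specification: with queries answered by `d`, the algorithm `T` stops
without tossing a coin, after at most `q` queries, with a result that satisfies `Q`. -/
def Ensures (d : X → X → ℝ) (T : QueryTree X α) (q : ℕ) (Q : α → Prop) : Prop :=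
  ∃ a m, Runs d T a m ∧ m ≤ q ∧ Q a

theorem ensures_output {a : α} {q : ℕ} {Q : α → Prop} (h : Q a) :
    Ensures d (output a) q Q :=
  ⟨a, 0, Runs.output a, Nat.zero_le _, h⟩

theorem ensures_query {x y : X} {next : ℝ → QueryTree X α} {q : ℕ} {Q : α → Prop}
    (h : Ensures d (next (d x y)) q Q) : Ensures d (query x y next) (q + 1) Q := by
  obtain ⟨a, m, h, hm, hQ⟩ := h
  exact ⟨a, m + 1, Runs.query h, by omega, hQ⟩

theorem Ensures.mono {T : QueryTree X α} {q q' : ℕ} {Q Q' : α → Prop} (h : Ensures d T q Q)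
    (hq : q ≤ q') (hQ : ∀ a, Q a → Q' a) : Ensures d T q' Q' := by
  obtain ⟨a, m, h, hm, hQa⟩ := h
  exact ⟨a, m, h, hm.trans hq, hQ a hQa⟩

theorem Ensures.bind {T : QueryTree X α} {f : α → QueryTree X β} {q q' : ℕ} {Q : α → Prop}
    {Q' : β → Prop} (h : Ensures d T q Q) (h' : ∀ a, Q a → Ensures d (f a) q' Q') :
    Ensures d (T.bind f) (q + q') Q' := by
  obtain ⟨a, m, h, hm, hQ⟩ := h
  obtain ⟨b, m', hb, hm', hQ'⟩ := h' a hQ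
  exact ⟨b, m + m', h.bind hb, by omega, hQ'⟩

/-- Run `step` on the current state, `m` times. -/
noncomputable def iterate (step : α → QueryTree X α) : ℕ → α → QueryTree X α
  | 0, a => output a
  | m + 1, a => (step a).bind (iterate step m)

theorem ensures_iterate {step : α → QueryTree X α} {q N : ℕ} {I : ℕ → α → Prop}
    (hstep : ∀ i a, i < N → I i a → Ensures d (step a) q (I (i + 1))) :
    ∀ (m i : ℕ) (a : α), i + m ≤ N → I i a → Ensures d (iterate step m a) (m * q) (I (i + m))
  | 0, _, _, _, h => ensures_output h
  | m + 1, i, a, hN, h => by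
    refine ((hstep i a (by omega) h).bind fun b hb =>
      ensures_iterate hstep m (i + 1) b (by omega) hb).mono ?_ ?_
    · rw [Nat.succ_mul, Nat.add_comm]
    · intro b hb
      rwa [show i + (m + 1) = i + 1 + m by omega]

/-- Run the algorithms `t i` for all `i` in a list and collect the results in a table. -/
noncomputable def tabulateList {ι : Type w} [Inhabited α] (t : ι → QueryTree X α) :
    List ι → QueryTree X (ι → α)
  | [] => output fun _ => default
  | i :: l => (t i).bind fun a => (tabulateList t l).bind fun g => output (Function.update g i a)

theorem ensures_tabulateList {ι : Type w} [Inhabited α] {t : ι → QueryTree X α} {q : ℕ}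
    {Q : ι → α → Prop} : ∀ l : List ι, (∀ i ∈ l, Ensures d (t i) q (Q i)) →
      Ensures d (tabulateList t l) (l.length * q)
        (fun g => (∀ i ∈ l, Q i (g i)) ∧ ∀ i ∉ l, g i = default)
  | [], _ => ensures_output (by simp)
  | i :: l, h => by
    refine ((h i (by simp)).bind (q' := l.length * q) fun a ha =>
      ((ensures_tabulateList l fun j hj => h j (by simp [hj])).bind (q' := 0) fun g hg =>
        ensures_output ⟨?_, ?_⟩)).mono (by rw [List.length_cons, Nat.succ_mul, Nat.add_comm])
          fun _ h => h
    · intro j hj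
      by_cases hji : j = i
      · subst hji
        simpa using ha
      · rw [Function.update_of_ne hji]
        exact hg.1 j (by simpa [hji] using hj)
    · intro j hj
      rw [List.mem_cons, not_or] at hj
      rw [Function.update_of_ne hj.1]
      exact hg.2 j hj.2

/-- Run the algorithms `t i` for all `i` in a finite set and collect the results in a table,
which has a default entry outside the set. -/
noncomputable def tabulate {ι : Type w} [Inhabited α] (t : ι → QueryTree X α) (s : Finset ι) :
    QueryTree X (ι → α) :=
  tabulateList t s.toList

theorem ensures_tabulate {ι : Type w} [Inhabited α] {t : ι → QueryTree X α} {q : ℕ}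
    {Q : ι → α → Prop} {s : Finset ι} (h : ∀ i ∈ s, Ensures d (t i) q (Q i)) :
    Ensures d (tabulate t s) (#s * q)
      (fun g => (∀ i ∈ s, Q i (g i)) ∧ ∀ i ∉ s, g i = default) := by
  simpa [tabulate] using ensures_tabulateList s.toList fun i hi => h i (by simpa using hi)

end QueryTree

open QueryTree

/-! ### Balls by binary search in the rankings -/

section Ball

variable {X : Type u} [Fintype X]

variable (X) in
/-- The number of binary digits of `|X|`. -/
def logSize : ℕ := Nat.log 2 (Fintype.card X) + 1

variable (X) in
theorem card_lt_two_pow_logSize : Fintype.card X < 2 ^ logSize X :=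
  Nat.lt_pow_succ_log_self (by norm_num) _

/-- Binary search for the number of points at distance at most `r` from `s`, when it is known to
lie in `[lo, lo + 2 ^ m)`: one query for each binary digit. -/
noncomputable def rankSearch (P : Profile X) (s : X) (r : ℝ) : ℕ → ℕ → QueryTree X ℕ
  | 0, lo => output lo
  | m + 1, lo =>
    if h : lo + 2 ^ m ≤ Fintype.card X then
      query s (P s ⟨lo + 2 ^ m - 1, by have := Nat.two_pow_pos m; omega⟩) fun v =>
        if v ≤ r then rankSearch P s r m (lo + 2 ^ m) else rankSearch P s r m lo
    else rankSearch P s r m lo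

/-- The closed ball around `s` of radius `r`. -/
noncomputable def ballQuery (P : Profile X) (s : X) (r : ℝ) : QueryTree X (Finset X) :=
  (rankSearch P s r (logSize X) 0).bind fun c =>
    output ({x | ((P s).symm x : ℕ) < c} : Finset X)

variable [MetricSpace X] {P : Profile X}

theorem Profile.Consistent.dist_le (hP : P.Consistent) {x y y' : X}
    (h : (P x).symm y ≤ (P x).symm y') : dist x y ≤ dist x y' := by
  rcases h.eq_or_lt with h | h
  · rw [(P x).symm.injective h]
  · simpa using hP x _ _ h

theorem ensures_rankSearch (hP : P.Consistent) (s : X) (r : ℝ) : ∀ (m lo : ℕ),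
    (∀ x, ((P s).symm x : ℕ) < lo → dist s x ≤ r) →
    (∀ x, lo + 2 ^ m ≤ ((P s).symm x : ℕ) + 1 → r < dist s x) →
    Ensures dist (rankSearch P s r m lo) m
      (fun c => ∀ x, ((P s).symm x : ℕ) < c ↔ dist s x ≤ r)
  | 0, lo, h₁, h₂ => ensures_output fun x => by
      refine ⟨h₁ x, fun h => ?_⟩
      by_contra hlt
      exact absurd h (h₂ x (by simp; omega)).not_ge
  | m + 1, lo, h₁, h₂ => by
    have hpos := Nat.two_pow_pos m
    rw [pow_succ] at h₂
    rw [rankSearch]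
    split_ifs with hn
    · refine ensures_query ?_
      have hmid : ((P s).symm (P s ⟨lo + 2 ^ m - 1, by omega⟩) : ℕ) = lo + 2 ^ m - 1 := by simp
      split_ifs with hv
      · refine ensures_rankSearch hP s r m _ (fun x hx => ?_) fun x hx => h₂ x (by omega)
        refine (hP.dist_le ?_).trans hv
        rw [Fin.le_def]
        omega
      · refine ensures_rankSearch hP s r m _ h₁ fun x hx => ?_
        refine (not_le.1 hv).trans_le (hP.dist_le ?_)
        rw [Fin.le_def]
        omega
    · refine (ensures_rankSearch hP s r m _ h₁ fun x hx => ?_).mono (Nat.le_succ _)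
        fun _ h => h
      have := ((P s).symm x).isLt
      omega

theorem ensures_ballQuery (hP : P.Consistent) (s : X) (r : ℝ) :
    Ensures dist (ballQuery P s r) (logSize X) (fun U => ∀ x, x ∈ U ↔ dist s x ≤ r) := by
  refine ((ensures_rankSearch hP s r (logSize X) 0 (by simp) fun x hx => ?_).bind (q' := 0)
    fun c hc => ensures_output ?_).mono le_rfl fun _ h => h
  · have := ((P s).symm x).isLt
    have := card_lt_two_pow_logSize X
    omega
  · simpa using hc

end Ball

/-! ### Nets for ranking prefixes -/

section Net

variable {X : Type u}

/-- Greedy hitting, with `𝓖` the sets that are still unhit: if every member of `𝓕` contains at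
least a `1 / q` fraction of `A`, some point of `A` lies in a `1 / q` fraction of the sets in `𝓖`,
so each further point leaves at most a `1 - 1 / q` fraction of them unhit. -/
theorem exists_hitting_set {A : Finset X} (hA : A.Nonempty) {q : ℕ} (hq : 1 ≤ q)
    (𝓕 : Finset (Finset X)) (h𝓕 : ∀ F ∈ 𝓕, #A ≤ q * #(A ∩ F)) (t : ℕ) :
    ∃ (S : Finset X) (𝓖 : Finset (Finset X)), #S ≤ t ∧
      (∀ F ∈ 𝓕, F ∉ 𝓖 → ∃ s ∈ S, s ∈ A ∧ s ∈ F) ∧ 𝓖 ⊆ 𝓕 ∧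
      (#𝓖 : ℝ) ≤ (1 - 1 / (q : ℝ)) ^ t * #𝓕 := by
  have hq0 : (0 : ℝ) < q := by exact_mod_cast hq
  induction t with
  | zero => exact ⟨∅, 𝓕, by simp, fun F hF hF' => absurd hF hF', Subset.rfl, by simp⟩
  | succ t ih =>
    obtain ⟨S, 𝓖, hS, hhit, hsub, hcard⟩ := ih
    have hdouble : ∑ a ∈ A, #{F ∈ 𝓖 | a ∈ F} = ∑ F ∈ 𝓖, #(A ∩ F) := by
      refine (sum_card_bipartiteAbove_eq_sum_card_bipartiteBelow (s := 𝓖) (t := A)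
        (fun F a => a ∈ F)).symm.trans (sum_congr rfl fun F _ => ?_)
      rw [bipartiteAbove, filter_mem_eq_inter]
    obtain ⟨a, haA, ha⟩ : ∃ a ∈ A, #𝓖 ≤ q * #{F ∈ 𝓖 | a ∈ F} := by
      by_contra! hlt
      have h₁ : q * ∑ a ∈ A, #{F ∈ 𝓖 | a ∈ F} < #A * #𝓖 := by
        rw [mul_sum, ← smul_eq_mul, ← sum_const]
        exact sum_lt_sum_of_nonempty hA hlt
      have h₂ : #A * #𝓖 ≤ q * ∑ F ∈ 𝓖, #(A ∩ F) := by
        rw [mul_sum, mul_comm, ← smul_eq_mul, ← sum_const]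
        exact sum_le_sum fun F hF => h𝓕 F (hsub hF)
      rw [hdouble] at h₁
      omega
    refine ⟨insert a S, {F ∈ 𝓖 | a ∉ F}, (card_insert_le _ _).trans (by omega),
      fun F hF hF' => ?_, (filter_subset _ _).trans hsub, ?_⟩
    · by_cases haF : a ∈ F
      · exact ⟨a, mem_insert_self a S, haA, haF⟩
      · obtain ⟨s, hs, h⟩ := hhit F hF fun hF𝓖 => hF' (mem_filter.2 ⟨hF𝓖, haF⟩)
        exact ⟨s, mem_insert_of_mem hs, h⟩
    have hsplit := card_filter_add_card_filter_not (s := 𝓖) (fun F => a ∈ F)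
    have h₂ : (#{F ∈ 𝓖 | a ∈ F} : ℝ) + #{F ∈ 𝓖 | a ∉ F} = #𝓖 := by exact_mod_cast hsplit
    have h₃ : (#𝓖 : ℝ) / q ≤ #{F ∈ 𝓖 | a ∈ F} := by
      rw [div_le_iff₀ hq0, mul_comm]
      exact_mod_cast ha
    have h₄ : (0 : ℝ) ≤ 1 - 1 / q := by
      rw [sub_nonneg, div_le_one hq0]
      exact_mod_cast hq
    calc (#{F ∈ 𝓖 | a ∉ F} : ℝ) ≤ #𝓖 - (#𝓖 : ℝ) / q := by linarith
      _ = (1 - 1 / (q : ℝ)) * #𝓖 := by ring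
      _ ≤ (1 - 1 / (q : ℝ)) * ((1 - 1 / (q : ℝ)) ^ t * #𝓕) :=
          mul_le_mul_of_nonneg_left hcard h₄
      _ = (1 - 1 / (q : ℝ)) ^ (t + 1) * #𝓕 := by ring

variable [Fintype X]

/-- `S` is a net for `A`: it meets the trace on `A` of every ranking prefix that contains at
least a `1 / q` fraction of `A`. -/
def IsNet (P : Profile X) (q : ℕ) (A S : Finset X) : Prop :=
  ∀ (y : X) (i : Fin (Fintype.card X)), #A ≤ q * #{x ∈ A | (P y).symm x ≤ i} →
    ∃ s ∈ S, s ∈ A ∧ (P y).symm s ≤ i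

/-- There are at most `|X| ^ 2` prefixes, so `2 q log₂ |X|` greedy steps hit all heavy ones. -/
theorem exists_isNet (P : Profile X) {q : ℕ} (hq : 1 ≤ q) {A : Finset X} (hA : A.Nonempty) :
    ∃ S : Finset X, #S ≤ q * (2 * logSize X) ∧ IsNet P q A S := by
  set n := Fintype.card X with hn
  set 𝓕 : Finset (Finset X) := ((univ : Finset (X × Fin n)).image fun p =>
    ({x | (P p.1).symm x ≤ p.2} : Finset X)).filter fun F => #A ≤ q * #(A ∩ F) with h𝓕
  obtain ⟨S, 𝓖, hS, hhit, -, hcard⟩ := exists_hitting_set hA hq 𝓕 (fun F hF => (mem_filter.1 hF).2)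
    (q * (2 * logSize X))
  refine ⟨S, hS, fun y i hheavy => ?_⟩
  have hq0 : (0 : ℝ) < q := by exact_mod_cast hq
  have hmem : ({x | (P y).symm x ≤ i} : Finset X) ∈ 𝓕 := by
    rw [h𝓕, mem_filter]
    refine ⟨mem_image.2 ⟨(y, i), mem_univ _, rfl⟩, ?_⟩
    rwa [← filter_mem_eq_inter, filter_congr (q := fun x => (P y).symm x ≤ i)
      (fun x _ => by simp)]
  have hF : (#𝓕 : ℝ) < 2 ^ (2 * logSize X) := by
    have h₁ : #𝓕 ≤ n * n := by
      refine (card_filter_le _ _).trans (card_image_le.trans ?_)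
      simp [hn]
    have h₂ : n * n < 2 ^ (2 * logSize X) := by
      have := card_lt_two_pow_logSize X
      rw [two_mul, pow_add]
      exact Nat.mul_lt_mul'' this this
    exact_mod_cast h₁.trans_lt h₂
  have hbase : (0 : ℝ) ≤ 1 - 1 / q := by
    rw [sub_nonneg, div_le_one hq0]
    exact_mod_cast hq
  have hpow : (1 - 1 / (q : ℝ)) ^ q ≤ 1 / 2 := by
    calc (1 - 1 / (q : ℝ)) ^ q ≤ Real.exp (-(1 / (q : ℝ))) ^ q := by
          gcongr
          exact Real.one_sub_le_exp_neg _
      _ = Real.exp (-1) := by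
          rw [← Real.exp_nat_mul]
          congr 1
          field_simp
      _ ≤ 1 / 2 := by
          rw [Real.exp_neg, one_div]
          gcongr
          have := Real.add_one_le_exp 1
          linarith
  have hlt : (1 - 1 / (q : ℝ)) ^ (q * (2 * logSize X)) * #𝓕 < 1 := by
    calc (1 - 1 / (q : ℝ)) ^ (q * (2 * logSize X)) * #𝓕
        ≤ (1 / 2) ^ (2 * logSize X) * #𝓕 := by
          rw [pow_mul]
          gcongr
      _ < (1 / 2) ^ (2 * logSize X) * 2 ^ (2 * logSize X) := by gcongr
      _ = 1 := by rw [← mul_pow]; norm_num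
  have hnone := hcard.trans_lt hlt
  rw [Nat.cast_lt_one, card_eq_zero] at hnone
  obtain ⟨s, hs, hsA, hsF⟩ := hhit _ hmem (by simp [hnone])
  exact ⟨s, hs, hsA, (mem_filter.1 hsF).2⟩

/-- A net for `A` of logarithmic size. The ranking prefixes do not depend on the metric, so no
query is needed to find it. -/
noncomputable def net (P : Profile X) (q : ℕ) (A : Finset X) : Finset X :=
  Classical.epsilon fun S => #S ≤ q * (2 * logSize X) ∧ (A.Nonempty → IsNet P q A S)

theorem net_spec (P : Profile X) {q : ℕ} (hq : 1 ≤ q) (A : Finset X) :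
    #(net P q A) ≤ q * (2 * logSize X) ∧ (A.Nonempty → IsNet P q A (net P q A)) := by
  refine Classical.epsilon_spec (p := fun S =>
    #S ≤ q * (2 * logSize X) ∧ (A.Nonempty → IsNet P q A S)) ?_
  by_cases hA : A.Nonempty
  · obtain ⟨S, h₁, h₂⟩ := exists_isNet P hq hA
    exact ⟨S, h₁, fun _ => h₂⟩
  · exact ⟨∅, by simp, fun h => absurd h hA⟩

end Net

/-! ### Covering all but few points at a fixed scale -/

section Cover

variable {X : Type u} [Fintype X]

/-- One round of covering at scale `r`. The state consists of the uncovered points and the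
centers found so far; the points of a net of the uncovered points become centers. -/
noncomputable def coverStep (P : Profile X) (k : ℕ) (r : ℝ) (st : Finset X × Finset X) :
    QueryTree X (Finset X × Finset X) :=
  (tabulate (fun s => ballQuery P s r) (net P (2 * k) st.1)).bind fun g =>
    output ({x ∈ st.1 | ∀ s ∈ net P (2 * k) st.1, x ∉ g s}, st.2 ∪ net P (2 * k) st.1)

/-- Centers that leave at most twice as many points uncovered at scale `r` as any `k` centers
leave uncovered at scale `r / 2`. -/
noncomputable def cover (P : Profile X) (k : ℕ) (r : ℝ) : QueryTree X (Finset X) :=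
  (iterate (coverStep P k r) (logSize X) (univ, ∅)).bind fun st => output st.2

variable [MetricSpace X] {P : Profile X}

/-- The points that a net of `A` leaves uncovered at scale `r` are the points that `O` does not
cover at scale `r / 2`, and points in the `k` clusters of `O`, each of which, having been missed
by the net, contains less than a `1 / (2 k)` fraction of `A`. -/
theorem card_uncovered_le (hP : P.Consistent) {k : ℕ} {A S O : Finset X}
    (hS : A.Nonempty → IsNet P (2 * k) A S) (hO : #O = k) (r : ℝ) :
    2 * #{x ∈ A | ∀ s ∈ S, r < dist s x} ≤ #A + 2 * #{x | ∀ o ∈ O, r / 2 < dist o x} := by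
  set F : Finset X := {x | ∀ o ∈ O, r / 2 < dist o x} with hF
  set L : Finset X := {o ∈ O | 2 * k * #{x ∈ A | dist o x ≤ r / 2} ≤ #A} with hL
  have hsub : ({x ∈ A | ∀ s ∈ S, r < dist s x} : Finset X) ⊆
      F ∪ L.biUnion fun o => {x ∈ A | dist o x ≤ r / 2} := by
    intro x hx
    obtain ⟨hxA, hxS⟩ := mem_filter.1 hx
    by_cases hxF : x ∈ F
    · exact mem_union_left _ hxF
    simp only [hF, mem_filter, mem_univ, true_and, not_forall, not_lt] at hxF
    obtain ⟨o, ho, hox⟩ := hxF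
    refine mem_union_right _ (mem_biUnion.2 ⟨o, mem_filter.2 ⟨ho, ?_⟩, by simp [hxA, hox]⟩)
    by_contra! hheavy
    -- The cluster of `o` is the trace on `A` of the prefix that ends with its last member.
    obtain ⟨y, hy, hmax⟩ := exists_max_image ({x ∈ A | dist o x ≤ r / 2} : Finset X)
      (fun x => (P o).symm x) ⟨x, by simp [hxA, hox]⟩
    have hprefix : ({x ∈ A | dist o x ≤ r / 2} : Finset X) =
        {x ∈ A | (P o).symm x ≤ (P o).symm y} := by
      ext w
      simp only [mem_filter, and_congr_right_iff]
      intro hw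
      refine ⟨fun h => hmax w (by simp [hw, h]), fun h => ?_⟩
      exact (hP.dist_le h).trans (mem_filter.1 hy).2
    rw [hprefix] at hheavy
    obtain ⟨s, hs, hsA, hsy⟩ := hS ⟨x, hxA⟩ o _ hheavy.le
    have h₁ : dist o s ≤ r / 2 := (hP.dist_le hsy).trans (mem_filter.1 hy).2
    have h₂ := dist_triangle_left s x o
    have h₃ := hxS s hs
    linarith
  have hLk : #L ≤ k := hO ▸ card_filter_le _ _
  have hunion : #(L.biUnion fun o => ({x ∈ A | dist o x ≤ r / 2} : Finset X)) * 2 ≤ #A := by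
    rcases Nat.eq_zero_or_pos k with hk | hk
    · have : L = ∅ := by rw [← card_eq_zero]; omega
      simp [this]
    have h₁ : (2 * k) * ∑ o ∈ L, #{x ∈ A | dist o x ≤ r / 2} ≤ k * #A := by
      rw [mul_sum]
      refine (sum_le_card_nsmul L _ (#A) fun o ho => (mem_filter.1 ho).2).trans ?_
      rw [smul_eq_mul]
      gcongr
    have h₂ : k * (2 * ∑ o ∈ L, #{x ∈ A | dist o x ≤ r / 2}) ≤ k * #A := by
      calc _ = (2 * k) * ∑ o ∈ L, #{x ∈ A | dist o x ≤ r / 2} := by ring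
        _ ≤ _ := h₁
    have h₃ := Nat.le_of_mul_le_mul_left h₂ hk
    have h₄ : #(L.biUnion fun o => ({x ∈ A | dist o x ≤ r / 2} : Finset X)) ≤
      ∑ o ∈ L, #{x ∈ A | dist o x ≤ r / 2} := card_biUnion_le
    omega
  have h₁ := card_le_card hsub
  have h₂ := card_union_le F (L.biUnion fun o => ({x ∈ A | dist o x ≤ r / 2} : Finset X))
  omega

/-- Every round halves the number of uncovered points, up to the points that the competing
centers leave uncovered as well. -/
theorem ensures_cover (hP : P.Consistent) {k : ℕ} (hk : 1 ≤ k) (r : ℝ) :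
    Ensures dist (cover P k r) (logSize X * (2 * k * (2 * logSize X) * logSize X)) (fun B =>
      #B ≤ logSize X * (2 * k * (2 * logSize X)) ∧ ∀ O : Finset X, #O = k →
        #{x | ∀ b ∈ B, r < dist b x} ≤ 2 * #{x | ∀ o ∈ O, r / 2 < dist o x}) := by
  set I : ℕ → Finset X × Finset X → Prop := fun i st =>
    #st.2 ≤ i * (2 * k * (2 * logSize X)) ∧ (∀ x, (∀ b ∈ st.2, r < dist b x) → x ∈ st.1) ∧
      ∀ O : Finset X, #O = k → 2 ^ i * #st.1 ≤
        Fintype.card X + 2 ^ (i + 1) * #{x | ∀ o ∈ O, r / 2 < dist o x} with hI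
  have hstep : ∀ i st, i < logSize X → I i st →
      Ensures dist (coverStep P k r st) (2 * k * (2 * logSize X) * logSize X) (I (i + 1)) := by
    intro i st _ hst
    obtain ⟨hcard, hnet⟩ := net_spec P (show 1 ≤ 2 * k by omega) st.1
    refine ((ensures_tabulate fun s _ => ensures_ballQuery hP s r).bind (q' := 0) fun g hg =>
      ensures_output ?_).mono (Nat.mul_le_mul_right _ hcard) fun _ h => h
    have hfilter : ({x ∈ st.1 | ∀ s ∈ net P (2 * k) st.1, x ∉ g s} : Finset X) =
        {x ∈ st.1 | ∀ s ∈ net P (2 * k) st.1, r < dist s x} := by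
      refine filter_congr fun x _ => forall₂_congr fun s hs => ?_
      rw [hg.1 s hs, not_le]
    refine ⟨?_, fun x hx => ?_, fun O hO => ?_⟩
    · refine (card_union_le _ _).trans ?_
      rw [Nat.succ_mul i]
      exact Nat.add_le_add hst.1 hcard
    · rw [hfilter]
      exact mem_filter.2 ⟨hst.2.1 x fun b hb => hx b (mem_union_left _ hb),
        fun s hs => hx s (mem_union_right _ hs)⟩
    · have h₁ := card_uncovered_le hP hnet hO r
      have h₂ := hst.2.2 O hO
      rw [hfilter]
      generalize #({x ∈ st.1 | ∀ s ∈ net P (2 * k) st.1, r < dist s x} : Finset X) = a at *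
      generalize #({x | ∀ o ∈ O, r / 2 < dist o x} : Finset X) = f at *
      calc 2 ^ (i + 1) * a = 2 ^ i * (2 * a) := by ring
        _ ≤ 2 ^ i * (#st.1 + 2 * f) := by gcongr
        _ = 2 ^ i * #st.1 + 2 ^ (i + 1) * f := by ring
        _ ≤ Fintype.card X + 2 ^ (i + 1) * f + 2 ^ (i + 1) * f := by gcongr
        _ = Fintype.card X + 2 ^ (i + 1 + 1) * f := by ring
  refine ((ensures_iterate hstep (logSize X) 0 (univ, ∅) (by simp) ?_).bind (q' := 0)
    fun st hst => ensures_output ⟨?_, fun O hO => ?_⟩).mono le_rfl fun _ h => h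
  · refine ⟨by simp, fun x _ => mem_univ x, fun O _ => ?_⟩
    simp
  · simpa using hst.1
  · have h₁ := hst.2.2 O hO
    rw [Nat.zero_add] at h₁
    have h₂ : #({x | ∀ b ∈ st.2, r < dist b x} : Finset X) ≤ #st.1 :=
      card_le_card fun x hx => hst.2.1 x (mem_filter.1 hx).2
    have h₃ := card_lt_two_pow_logSize X
    refine h₂.trans ?_
    have h₄ : 2 ^ logSize X * #st.1 <
        2 ^ logSize X * (1 + 2 * #{x | ∀ o ∈ O, r / 2 < dist o x}) := by
      rw [pow_succ] at h₁
      linarith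
    have := Nat.lt_of_mul_lt_mul_left h₄
    omega

end Cover

/-! ### The order of magnitude of the optimal cost -/

section Scale

variable {X : Type u} [Fintype X]

/-- The points whose ranking places `c` before all other members of `C`. -/
noncomputable def cell (P : Profile X) (C : Finset X) (c : X) : Finset X :=
  {x | ∀ c' ∈ C, (P x).symm c ≤ (P x).symm c'}

/-- The member of the cell of `c` that `c` ranks last. -/
noncomputable def lastInCell [Nonempty X] (P : Profile X) (C : Finset X) (c : X) : X :=
  Classical.epsilon fun x => x ∈ cell P C c ∧ ∀ y ∈ cell P C c, (P c).symm y ≤ (P c).symm x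

/-- A point at maximal distance from `C`, and this distance. By consistency it is the last point
of one of the cells, so one query for each member of `C` suffices. -/
noncomputable def farthest [Nonempty X] (P : Profile X) (C : Finset X) : QueryTree X (X × ℝ) :=
  (tabulate (fun c => query c (lastInCell P C c) output) C).bind fun g =>
    output (Classical.epsilon fun p : X × ℝ =>
      ∃ c ∈ C, p = (lastInCell P C c, g c) ∧ ∀ c' ∈ C, g c' ≤ g c)

/-- Farthest-point traversal: the distance at which `k` centers, chosen greedily, cover all
points. -/
noncomputable def scaleQuery [Nonempty X] (P : Profile X) (k : ℕ) : QueryTree X ℝ :=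
  (iterate (fun C => (farthest P C).bind fun p => output (insert p.1 C)) (k - 1)
    {Classical.arbitrary X}).bind fun C => (farthest P C).bind fun p => output p.2

variable [MetricSpace X] {P : Profile X}

theorem lastInCell_spec [Nonempty X] (hP : P.Consistent) {C : Finset X} {c : X} :
    lastInCell P C c ∈ cell P C c ∧ ∀ y ∈ cell P C c, dist c y ≤ dist c (lastInCell P C c) := by
  have hself : c ∈ cell P C c := by
    refine mem_filter.2 ⟨mem_univ c, fun c' _ => ?_⟩
    by_contra! hlt
    have h := hP.dist_le hlt.le
    rw [dist_self, dist_le_zero] at h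
    exact hlt.ne (h ▸ rfl)
  have h := Classical.epsilon_spec (p := fun x =>
    x ∈ cell P C c ∧ ∀ y ∈ cell P C c, (P c).symm y ≤ (P c).symm x)
      (exists_max_image (cell P C c) (fun x => (P c).symm x) ⟨c, hself⟩)
  exact ⟨h.1, fun y hy => hP.dist_le (h.2 y hy)⟩

theorem ensures_farthest [Nonempty X] (hP : P.Consistent) {C : Finset X} (hC : C.Nonempty) :
    Ensures dist (farthest P C) #C
      (fun p => (∀ c ∈ C, p.2 ≤ dist c p.1) ∧ ∀ x, ∃ c ∈ C, dist c x ≤ p.2) := by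
  refine ((ensures_tabulate (q := 1) (Q := fun c v => v = dist c (lastInCell P C c))
    fun c _ => ensures_query (ensures_output rfl)).bind (q' := 0) fun g hg =>
      ensures_output ?_).mono (by simp) fun _ h => h
  obtain ⟨c₀, hc₀, hmax₀⟩ := exists_max_image C g hC
  obtain ⟨c, hc, hp, hmax⟩ := Classical.epsilon_spec (p := fun p : X × ℝ =>
      ∃ c ∈ C, p = (lastInCell P C c, g c) ∧ ∀ c' ∈ C, g c' ≤ g c) ⟨_, c₀, hc₀, rfl, hmax₀⟩
  rw [hp]
  refine ⟨fun c' hc' => ?_, fun x => ?_⟩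
  · have h := (mem_filter.1 (lastInCell_spec hP (C := C) (c := c)).1).2 c' hc'
    simp only [hg.1 c hc]
    rw [dist_comm c, dist_comm c']
    exact hP.dist_le h
  · obtain ⟨c', hc', hmin⟩ := exists_min_image C (fun c => (P x).symm c) hC
    refine ⟨c', hc', le_trans ?_ (hmax c' hc')⟩
    rw [hg.1 c' hc']
    exact (lastInCell_spec hP).2 x (mem_filter.2 ⟨mem_univ x, hmin⟩)

/-- The traversal is the classical 2-approximation for the `k`-center problem: `k + 1` points at
mutual distances at least `R` cannot all be closer than `R / 2` to `k` centers. -/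
theorem ensures_scaleQuery [Nonempty X] (hP : P.Consistent) {k : ℕ} (hk : 1 ≤ k)
    (hkX : k < Fintype.card X) :
    Ensures dist (scaleQuery P k) (k * k) (fun R => 0 < R ∧
      (∃ C : Finset X, #C = k ∧ ∀ x, ∃ c ∈ C, dist c x ≤ R) ∧
      ∀ O : Finset X, #O = k → ∃ x, ∀ o ∈ O, R / 2 ≤ dist o x) := by
  have hpos : ∀ (C : Finset X) (p : X × ℝ), #C ≤ k → (∀ x, ∃ c ∈ C, dist c x ≤ p.2) →
      0 < p.2 := by
    intro C p hC h₂
    by_contra! hp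
    have huniv : C = univ := by
      refine eq_univ_of_forall fun x => ?_
      obtain ⟨c, hc, hcx⟩ := h₂ x
      rwa [← dist_le_zero.1 (hcx.trans hp)]
    rw [huniv, card_univ] at hC
    omega
  have hnotMem : ∀ (C : Finset X) (p : X × ℝ), 0 < p.2 → (∀ c ∈ C, p.2 ≤ dist c p.1) →
      p.1 ∉ C := by
    intro C p hp h hmem
    have := h _ hmem
    rw [dist_self] at this
    linarith
  set I : ℕ → Finset X → Prop := fun i C => #C = i + 1 ∧
    ∃ ρ, (∀ x, ∃ c ∈ C, dist c x ≤ ρ) ∧ (C : Set X).Pairwise fun c c' => ρ ≤ dist c c' with hI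
  have hinsert : ∀ (C : Finset X) (p : X × ℝ) (ρ : ℝ), (∀ x, ∃ c ∈ C, dist c x ≤ ρ) →
      ((C : Set X).Pairwise fun c c' => ρ ≤ dist c c') → (∀ c ∈ C, p.2 ≤ dist c p.1) →
      ((insert p.1 C : Finset X) : Set X).Pairwise fun c c' => p.2 ≤ dist c c' := by
    intro C p ρ hcov hsep hp
    obtain ⟨c, hc, hcp⟩ := hcov p.1
    rw [coe_insert, Set.pairwise_insert]
    refine ⟨hsep.mono' fun a b hab => ((hp c hc).trans hcp).trans hab, fun b hb _ => ?_⟩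
    exact ⟨dist_comm b p.1 ▸ hp b hb, hp b hb⟩
  have hstep : ∀ i C, i < k - 1 → I i C → Ensures dist
      ((farthest P C).bind fun p => output (insert p.1 C)) k (I (i + 1)) := by
    rintro i C hi ⟨hcard, ρ, hcov, hsep⟩
    refine ((ensures_farthest hP (card_pos.1 (by omega))).bind (q' := 0) fun p hp =>
      ensures_output ?_).mono (by omega) fun _ h => h
    refine ⟨?_, p.2, fun x => ?_, hinsert C p ρ hcov hsep hp.1⟩
    · rw [card_insert_of_notMem (hnotMem C p (hpos C p (by omega) hp.2) hp.1), hcard]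
    · obtain ⟨c, hc, h⟩ := hp.2 x
      exact ⟨c, mem_insert_of_mem hc, h⟩
  refine ((ensures_iterate hstep (k - 1) 0 _ (by omega) ?_).bind (q' := k) ?_).mono ?_
    fun _ h => h
  · obtain ⟨ρ, hρ⟩ := (univ.image fun x => dist (Classical.arbitrary X) x).bddAbove
    refine ⟨by simp, ρ, fun x => ⟨_, mem_singleton_self _, hρ (by simp)⟩, by simp⟩
  · rintro C ⟨hcard, ρ, hcov, hsep⟩
    refine ((ensures_farthest hP (card_pos.1 (by omega))).bind (q' := 0) fun p hp =>
      ensures_output ?_).mono (by omega) fun _ h => h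
    have hp0 := hpos C p (by omega) hp.2
    refine ⟨hp0, ⟨C, by omega, hp.2⟩, fun O hO => ?_⟩
    by_contra! hclose
    choose o ho hdist using hclose
    obtain ⟨x, hx, y, hy, hxy, heq⟩ := exists_ne_map_eq_of_card_lt_of_maps_to
      (s := insert p.1 C) (t := O) (f := o)
      (by rw [card_insert_of_notMem (hnotMem C p hp0 hp.1)]; omega) fun x _ => ho x
    have h₁ := hinsert C p ρ hcov hsep hp.1 hx hy hxy
    have h₂ := hdist x
    have h₃ := hdist y
    rw [← heq] at h₃
    have h₄ := dist_triangle_left x y (o x)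
    linarith
  · rw [← Nat.succ_mul]
    exact Nat.mul_le_mul_right _ (by omega)

end Scale

/-! ### Layer-cake sums over geometric scales -/

section Layers

variable {r : ℕ → ℝ} {z : ℕ}

theorem layer_weight_nonneg (hr : ∀ j, 0 ≤ r j) (hr2 : ∀ j, r j = 2 * r (j + 1)) (j : ℕ) :
    0 ≤ r j ^ z - r (j + 1) ^ z := by
  rw [sub_nonneg]
  have := hr (j + 1)
  exact pow_le_pow_left₀ this (by linarith [hr2 j]) z

theorem pow_le_layer_sum (hr : ∀ j, 0 ≤ r j) (hr2 : ∀ j, r j = 2 * r (j + 1)) {a : ℝ}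
    (ha : 0 ≤ a) (ha0 : a ≤ r 0) (J : ℕ) :
    a ^ z ≤ r J ^ z + ∑ j ∈ range J, if r (j + 1) < a then r j ^ z - r (j + 1) ^ z else 0 := by
  induction J with
  | zero => simpa using pow_le_pow_left₀ ha ha0 z
  | succ J ih =>
    rw [sum_range_succ]
    split_ifs with h
    · linarith
    · have h₁ := pow_le_pow_left₀ ha (not_lt.1 h) z
      have h₂ : 0 ≤ ∑ j ∈ range J, if r (j + 1) < a then r j ^ z - r (j + 1) ^ z else 0 := by
        refine sum_nonneg fun j _ => ?_
        split_ifs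
        · exact layer_weight_nonneg hr hr2 j
        · exact le_rfl
      linarith

theorem layer_sum_le_pow (hr : ∀ j, 0 ≤ r j) (hr2 : ∀ j, r j = 2 * r (j + 1)) {a : ℝ}
    (ha : 0 ≤ a) (J : ℕ) :
    ∑ j ∈ range J, (if r (j + 1) < a then r j ^ z - r (j + 1) ^ z else 0) ≤ (2 * a) ^ z := by
  have hanti : Antitone r := antitone_nat_of_succ_le fun j => by linarith [hr2 j, hr (j + 1)]
  have hzero : ∀ J, a ≤ r J →
      ∑ j ∈ range J, (if r (j + 1) < a then r j ^ z - r (j + 1) ^ z else 0) = 0 := by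
    refine fun J hJ => sum_eq_zero fun j hj => if_neg (not_lt.2 ?_)
    exact hJ.trans (hanti (by simpa using hj))
  -- The layers below `a` telescope.
  have hsum : ∀ J, r J < a → r J ^ z +
      ∑ j ∈ range J, (if r (j + 1) < a then r j ^ z - r (j + 1) ^ z else 0) ≤ (2 * a) ^ z := by
    intro J
    induction J with
    | zero =>
      intro h
      simpa using pow_le_pow_left₀ (hr 0) (by linarith) z
    | succ J ih =>
      intro h
      rw [sum_range_succ, if_pos h]
      rcases lt_or_ge (r J) a with hJ | hJ
      · linarith [ih hJ]
      · rw [hzero J hJ]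
        have := pow_le_pow_left₀ (hr J) (show r J ≤ 2 * a by linarith [hr2 J]) z
        linarith
  rcases lt_or_ge (r J) a with hJ | hJ
  · linarith [hsum J hJ, pow_nonneg (hr J) z]
  · rw [hzero J hJ]
    positivity

variable {X : Type u} [Fintype X]

theorem sum_layer_eq (f : X → ℝ) (J : ℕ) :
    ∑ j ∈ range J, (#{x | r (j + 1) < f x} : ℝ) * (r j ^ z - r (j + 1) ^ z) =
      ∑ x, ∑ j ∈ range J, if r (j + 1) < f x then r j ^ z - r (j + 1) ^ z else 0 := by
  rw [sum_comm]
  refine sum_congr rfl fun j _ => ?_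
  rw [← sum_filter, sum_const, nsmul_eq_mul]

theorem sum_pow_le_of_card_le (hr : ∀ j, 0 ≤ r j) (hr2 : ∀ j, r j = 2 * r (j + 1)) {f : X → ℝ}
    (hf : ∀ x, 0 ≤ f x) (hf0 : ∀ x, f x ≤ r 0) {J : ℕ} {N : ℕ → ℝ}
    (hN : ∀ j < J, (#{x | r (j + 1) < f x} : ℝ) ≤ N j) :
    ∑ x, f x ^ z ≤ Fintype.card X * r J ^ z +
      ∑ j ∈ range J, N j * (r j ^ z - r (j + 1) ^ z) := by
  calc ∑ x, f x ^ z ≤ ∑ x, (r J ^ z +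
        ∑ j ∈ range J, if r (j + 1) < f x then r j ^ z - r (j + 1) ^ z else 0) :=
        sum_le_sum fun x _ => pow_le_layer_sum hr hr2 (hf x) (hf0 x) J
    _ = Fintype.card X * r J ^ z +
        ∑ j ∈ range J, (#{x | r (j + 1) < f x} : ℝ) * (r j ^ z - r (j + 1) ^ z) := by
        rw [sum_add_distrib, sum_layer_eq, sum_const, nsmul_eq_mul, card_univ]
    _ ≤ _ := by
        gcongr with j hj
        · exact layer_weight_nonneg hr hr2 j
        · exact hN j (mem_range.1 hj)

theorem layer_sum_card_le (hr : ∀ j, 0 ≤ r j) (hr2 : ∀ j, r j = 2 * r (j + 1)) {f : X → ℝ}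
    (hf : ∀ x, 0 ≤ f x) (J : ℕ) :
    ∑ j ∈ range J, (#{x | r (j + 1) < f x} : ℝ) * (r j ^ z - r (j + 1) ^ z) ≤
      ∑ x, (2 * f x) ^ z := by
  rw [sum_layer_eq]
  exact sum_le_sum fun x _ => layer_sum_le_pow hr hr2 (hf x) J

end Layers

/-! ### The algorithm and its analysis -/

section Algorithm

theorem lt_infDist_iff {X : Type u} [MetricSpace X] {C : Finset X} (hC : C.Nonempty) {x : X}
    {t : ℝ} :
    t < Metric.infDist x (C : Set X) ↔ ∀ c ∈ C, t < dist c x := by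
  refine ⟨fun h c hc => h.trans_le ?_, fun h => ?_⟩
  · rw [dist_comm]
    exact Metric.infDist_le_dist_of_mem (mem_coe.2 hc)
  · obtain ⟨c, hc, heq⟩ := C.finite_toSet.isCompact.exists_infDist_eq_dist (by simpa using hC) x
    rw [heq, dist_comm]
    exact h c hc

theorem infDist_le_iff {X : Type u} [MetricSpace X] {C : Finset X} (hC : C.Nonempty) {x : X}
    {t : ℝ} :
    Metric.infDist x (C : Set X) ≤ t ↔ ∃ c ∈ C, dist c x ≤ t := by
  rw [← not_lt, lt_infDist_iff hC]
  simp

variable {X : Type u} [Fintype X]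

variable (X) in
/-- Geometric scales. If `k` centers cover all points at distance `R`, the optimal cost is at most
`|X| * R`; the first scale is larger than this by a factor that leaves room for the candidates. -/
noncomputable def scale (R : ℝ) (j : ℕ) : ℝ :=
  8 * Fintype.card X * R / 2 ^ j

variable (X) in
/-- The number of scales in use. The last one is at most `R / |X|`, and the points below it
contribute no more than `R ^ z` to the `z`-th power of the cost. -/
def levels : ℕ := 2 * logSize X + 4

/-- An estimate for the `z`-th power of the cost of `C`, by a layer-cake sum over the scales.
The table `near` holds the points `near (c, j)` that `c` is known to cover at scale `r j`. -/
noncomputable def layerScore (r : ℕ → ℝ) (J z : ℕ) (near : X × ℕ → Finset X) (C : Finset X) : ℝ :=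
  ∑ j ∈ range J, (#{x | ∀ c ∈ C, x ∉ near (c, j + 1)} : ℝ) * (r j ^ z - r (j + 1) ^ z)

/-- `C` consists of `k` centers, is known to cover all points at the largest scale, and has the
least score among such sets. -/
def IsBest (r : ℕ → ℝ) (J k z : ℕ) (near : X × ℕ → Finset X) (C : Finset X) : Prop :=
  #C = k ∧ (∀ x, ∃ c ∈ C, x ∈ near (c, 0)) ∧ ∀ C' : Finset X, #C' = k →
    (∀ x, ∃ c ∈ C', x ∈ near (c, 0)) → layerScore r J z near C ≤ layerScore r J z near C'

/-- The algorithm for `k < |X|`: estimate the scale of the instance, find candidate centers at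
each scale, learn the balls around all candidates, and choose the `k` centers of least score. -/
noncomputable def clusterTree [Nonempty X] (k z : ℕ) (P : Profile X) : QueryTree X (Finset X) :=
  (scaleQuery P k).bind fun R =>
    (tabulate (fun j => cover P k (scale X R j)) (range (levels X))).bind fun g =>
      (tabulate (fun p : X × ℕ => ballQuery P p.1 (scale X R p.2))
        ((range (levels X)).biUnion g ×ˢ range (levels X))).bind fun near =>
          output (Classical.epsilon (IsBest (scale X R) (levels X - 1) k z near))

/-- The algorithm; if there are no more than `k` points, all of them become centers. -/
noncomputable def clusterAlgorithm : ClusteringAlgorithm.{u} := fun X _ k z P =>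
  if h : k < Fintype.card X then
    haveI : Nonempty X := Fintype.card_pos_iff.1 (by omega)
    clusterTree k z P
  else output univ

theorem scale_eq (R : ℝ) (j : ℕ) : scale X R j = 2 * scale X R (j + 1) := by
  rw [scale, scale, pow_succ]
  field_simp

theorem scale_nonneg {R : ℝ} (hR : 0 ≤ R) (j : ℕ) : 0 ≤ scale X R j := by
  unfold scale
  positivity

theorem scale_three (R : ℝ) : scale X R 3 = Fintype.card X * R := by
  rw [scale]
  ring

theorem card_mul_scale_pow_le [Nonempty X] {R : ℝ} (hR : 0 ≤ R) {z : ℕ} (hz : 1 ≤ z) :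
    Fintype.card X * scale X R (levels X - 1) ^ z ≤ R ^ z := by
  have hn : (0 : ℝ) < Fintype.card X := by exact_mod_cast Fintype.card_pos
  have hn1 : (1 : ℝ) ≤ Fintype.card X := by exact_mod_cast Fintype.card_pos
  have hlt : (Fintype.card X : ℝ) ≤ 2 ^ logSize X := by
    exact_mod_cast (card_lt_two_pow_logSize X).le
  have hscale : scale X R (levels X - 1) ≤ R / Fintype.card X := by
    rw [scale, levels, show 2 * logSize X + 4 - 1 = logSize X + logSize X + 3 by omega,
      div_le_div_iff₀ (by positivity) hn]
    calc 8 * Fintype.card X * R * Fintype.card X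
        = R * (Fintype.card X * Fintype.card X * 2 ^ 3) := by ring
      _ ≤ R * (2 ^ logSize X * 2 ^ logSize X * 2 ^ 3) := by gcongr
      _ = R * 2 ^ (logSize X + logSize X + 3) := by rw [pow_add, pow_add]
  calc Fintype.card X * scale X R (levels X - 1) ^ z
      ≤ Fintype.card X * (R / Fintype.card X) ^ z := by
        gcongr
        exact scale_nonneg hR _
    _ ≤ (Fintype.card X) ^ z * (R / Fintype.card X) ^ z := by
        gcongr
        exact le_self_pow₀ hn1 (by omega)
    _ = R ^ z := by rw [← mul_pow, mul_div_cancel₀ _ hn.ne']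

/-- The number of queries is `O(k ^ 2 + k log ^ 5 |X|)`. -/
theorem query_bound {k : ℕ} (hk : 1 ≤ k) (hkX : k < Fintype.card X) :
    ((k * k + levels X * (logSize X * (2 * k * (2 * logSize X) * logSize X)) +
        levels X * (logSize X * (2 * k * (2 * logSize X))) * levels X * logSize X : ℕ) : ℝ) ≤
      81 * 3 ^ 5 * (k : ℝ) ^ 4 * Real.log (Fintype.card X) ^ 5 := by
  have hn : 2 ≤ Fintype.card X := by omega
  have hl : 2 ≤ logSize X := by
    have := Nat.log_pos (b := 2) (by norm_num) hn
    rw [logSize]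
    omega
  have hlev : levels X ≤ 4 * logSize X := by
    rw [levels]
    omega
  have hlog : (logSize X : ℝ) ≤ 3 * Real.log (Fintype.card X) := by
    have h2 := Real.log_two_gt_d9
    have h₁ : (Nat.log 2 (Fintype.card X) : ℝ) * Real.log 2 ≤ Real.log (Fintype.card X) := by
      rw [← Real.log_pow]
      refine Real.log_le_log (by positivity) ?_
      exact_mod_cast Nat.pow_log_le_self 2 (by omega)
    have h₂ : Real.log 2 ≤ Real.log (Fintype.card X) :=
      Real.log_le_log (by norm_num) (by exact_mod_cast hn)
    have h₃ : (logSize X : ℝ) = Nat.log 2 (Fintype.card X) + 1 := by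
      rw [logSize]
      push_cast
      rfl
    have h₄ : (0 : ℝ) ≤ Nat.log 2 (Fintype.card X) := by positivity
    rw [h₃]
    nlinarith
  have hnat : k * k + levels X * (logSize X * (2 * k * (2 * logSize X) * logSize X)) +
      levels X * (logSize X * (2 * k * (2 * logSize X))) * levels X * logSize X ≤
      81 * k ^ 4 * logSize X ^ 5 := by
    have hl1 : 1 ≤ logSize X := by omega
    generalize logSize X = l at *
    calc _ ≤ k * k + 4 * l * (l * (2 * k * (2 * l) * l)) +
          4 * l * (l * (2 * k * (2 * l))) * (4 * l) * l := by gcongr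
      _ = k ^ 2 * 1 + 16 * (k ^ 1 * l ^ 4) + 64 * (k ^ 1 * l ^ 5) := by ring
      _ ≤ k ^ 4 * l ^ 5 + 16 * (k ^ 4 * l ^ 5) + 64 * (k ^ 4 * l ^ 5) := by
          gcongr
          · omega
          · exact Nat.one_le_pow _ _ hl1
          · omega
          · omega
          · omega
      _ = 81 * k ^ 4 * l ^ 5 := by ring
  calc _ ≤ ((81 * k ^ 4 * logSize X ^ 5 : ℕ) : ℝ) := by exact_mod_cast hnat
    _ = 81 * (k : ℝ) ^ 4 * (logSize X : ℝ) ^ 5 := by push_cast; ring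
    _ ≤ 81 * (k : ℝ) ^ 4 * (3 * Real.log (Fintype.card X)) ^ 5 := by gcongr
    _ = _ := by ring

variable [MetricSpace X] {P : Profile X}

theorem cost_le_of_sum_le {z : ℕ} (hz : 1 ≤ z) {C O : Finset X} {D : ℝ} (hD : 0 ≤ D)
    (h : ∑ x, Metric.infDist x (C : Set X) ^ z ≤ D ^ z * ∑ x, Metric.infDist x (O : Set X) ^ z) :
    cost z C ≤ D * cost z O := by
  have hnonneg : ∀ C : Finset X, 0 ≤ ∑ x, Metric.infDist x (C : Set X) ^ z := fun C =>
    sum_nonneg fun x _ => pow_nonneg Metric.infDist_nonneg z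
  calc cost z C ≤ (D ^ z * ∑ x, Metric.infDist x (O : Set X) ^ z) ^ (1 / (z : ℝ)) :=
        Real.rpow_le_rpow (hnonneg C) h (by positivity)
    _ = D * cost z O := by
        rw [Real.mul_rpow (by positivity) (hnonneg O), one_div,
          Real.pow_rpow_inv_natCast hD (by omega), cost, one_div]

theorem sum_le_of_cost_le {z : ℕ} (hz : 1 ≤ z) {C O : Finset X} (h : cost z C ≤ cost z O) :
    ∑ x, Metric.infDist x (C : Set X) ^ z ≤ ∑ x, Metric.infDist x (O : Set X) ^ z := by
  have hnonneg : ∀ C : Finset X, 0 ≤ ∑ x, Metric.infDist x (C : Set X) ^ z := fun C =>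
    sum_nonneg fun x _ => pow_nonneg Metric.infDist_nonneg z
  refine (Real.rpow_le_rpow_iff (hnonneg C) (hnonneg O) ?_).1 h
  positivity

/-- Assigning each center of `O` to its nearest candidate in `B` gives at most `|O|` candidates
whose distances are controlled by those of `O` and of `B`. -/
theorem exists_snap {O B : Finset X} (hO : O.Nonempty) (hB : B.Nonempty) {k : ℕ} (hOk : #O = k) :
    ∃ C : Finset X, #C = k ∧ ∀ x, ∃ b ∈ C, b ∈ B ∧
      dist b x ≤ 2 * Metric.infDist x (O : Set X) + Metric.infDist x (B : Set X) := by
  have hnear : ∀ o, ∃ b ∈ B, dist b o ≤ Metric.infDist o (B : Set X) := fun o =>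
    (infDist_le_iff hB).1 le_rfl
  choose b hb hbo using hnear
  obtain ⟨C, hC, -, hCk⟩ := exists_subsuperset_card_eq (n := k) (subset_univ (O.image b))
    (hOk ▸ card_image_le) (hOk ▸ card_le_univ O)
  refine ⟨C, hCk, fun x => ?_⟩
  obtain ⟨o, ho, hox⟩ := (infDist_le_iff (x := x) hO).1 le_rfl
  refine ⟨b o, hC (mem_image_of_mem b ho), hb o, ?_⟩
  have h₁ := dist_triangle (b o) o x
  have h₂ := hbo o
  have h₃ : Metric.infDist o (B : Set X) ≤ Metric.infDist x (B : Set X) + dist o x :=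
    Metric.infDist_le_infDist_add_dist
  linarith

/-- The core of the distortion bound. With `g` and `f` the distances to `O` and to the candidates
`B`, the layer-cake formula turns the covering property of the candidates into
`∑ f ^ z ≤ 3 * 4 ^ z * ∑ g ^ z`. By `exists_snap` some `k` candidates are within `2 g + f`, and
the chosen centers do at least as well up to constants. -/
theorem isBest_spec [Nonempty X] {k z : ℕ} (hk : 1 ≤ k) (hz : 1 ≤ z) {R : ℝ} (hR : 0 < R)
    {C₀ : Finset X} (hC₀ : #C₀ = k) (hcov : ∀ x, ∃ c ∈ C₀, dist c x ≤ R) {O : Finset X}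
    (hO : IsOptimal k z O) (hfar : ∃ x, ∀ o ∈ O, R / 2 ≤ dist o x) {G : ℕ → Finset X}
    (hG : ∀ j < levels X, #{x | ∀ b ∈ G j, scale X R j < dist b x} ≤
      2 * #{x | ∀ o ∈ O, scale X R j / 2 < dist o x})
    {near : X × ℕ → Finset X}
    (hnear : ∀ b ∈ (range (levels X)).biUnion G, ∀ j < levels X, ∀ x,
      x ∈ near (b, j) ↔ dist b x ≤ scale X R j)
    (hnear' : ∀ b ∉ (range (levels X)).biUnion G, ∀ j, near (b, j) = ∅) :
    (∃ C, IsBest (scale X R) (levels X - 1) k z near C) ∧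
      ∀ C, IsBest (scale X R) (levels X - 1) k z near C → cost z C ≤ 80 * cost z O := by
  set r := scale X R with hr
  set B := (range (levels X)).biUnion G with hB
  set J := levels X - 1 with hJ
  have hlev : levels X = J + 1 := by rw [hJ, levels]; omega
  have hJ4 : 3 ≤ J := by rw [hJ, levels]; omega
  have hr0 : ∀ j, 0 ≤ r j := scale_nonneg hR.le
  have hr2 : ∀ j, r j = 2 * r (j + 1) := scale_eq R
  have hr3 : r 3 = Fintype.card X * R := scale_three R
  have hn1 : (1 : ℝ) ≤ Fintype.card X := by exact_mod_cast Fintype.card_pos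
  have hON : O.Nonempty := card_pos.1 (by have := hO.1; omega)
  have hC₀N : C₀.Nonempty := card_pos.1 (by omega)
  set g : X → ℝ := fun x => Metric.infDist x (O : Set X) with hg
  set f : X → ℝ := fun x => Metric.infDist x (B : Set X) with hf
  have hg0 : ∀ x, 0 ≤ g x := fun x => Metric.infDist_nonneg
  have hf0 : ∀ x, 0 ≤ f x := fun x => Metric.infDist_nonneg
  have hRG : R ^ z ≤ 2 ^ z * ∑ x, g x ^ z := by
    obtain ⟨x, hx⟩ := hfar
    have h₁ : R ≤ 2 * g x := by
      obtain ⟨o, ho, hox⟩ := (infDist_le_iff (x := x) (t := g x) hON).1 le_rfl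
      linarith [hx o ho]
    calc R ^ z ≤ (2 * g x) ^ z := pow_le_pow_left₀ hR.le h₁ z
      _ = 2 ^ z * g x ^ z := mul_pow _ _ _
      _ ≤ 2 ^ z * ∑ x, g x ^ z := by
        gcongr
        exact single_le_sum (f := fun x => g x ^ z) (fun x _ => pow_nonneg (hg0 x) z)
          (mem_univ x)
  have hgr3 : ∀ x, g x ≤ r 3 := by
    intro x
    refine le_of_pow_le_pow_left₀ (n := z) (by omega) (hr0 3) ?_
    calc g x ^ z ≤ ∑ x, g x ^ z := single_le_sum (f := fun x => g x ^ z)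
          (fun x _ => pow_nonneg (hg0 x) z) (mem_univ x)
      _ ≤ ∑ x, Metric.infDist x (C₀ : Set X) ^ z := sum_le_of_cost_le hz (hO.2 C₀ hC₀)
      _ ≤ ∑ _x : X, R ^ z := by
        refine sum_le_sum fun x _ => pow_le_pow_left₀ Metric.infDist_nonneg ?_ z
        exact (infDist_le_iff hC₀N).2 (hcov x)
      _ = Fintype.card X * R ^ z := by rw [sum_const, nsmul_eq_mul, card_univ]
      _ ≤ (Fintype.card X) ^ z * R ^ z := by
        gcongr
        exact le_self_pow₀ hn1 (by omega)
      _ = r 3 ^ z := by rw [hr3, mul_pow]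
  have hcovB : ∀ x, ∃ b ∈ B, dist b x ≤ r 2 := by
    have h₁ : #{x | ∀ o ∈ O, r 2 / 2 < dist o x} = 0 := by
      rw [card_eq_zero, filter_eq_empty_iff]
      intro x _ hx
      rw [hr2 2, mul_div_cancel_left₀ _ (by norm_num), ← lt_infDist_iff hON] at hx
      exact (hgr3 x).not_gt hx
    have h₂ := hG 2 (by omega)
    rw [h₁, mul_zero, Nat.le_zero, card_eq_zero, filter_eq_empty_iff] at h₂
    intro x
    have h₃ := h₂ (mem_univ x)
    push Not at h₃
    obtain ⟨b, hb, hbx⟩ := h₃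
    exact ⟨b, mem_biUnion.2 ⟨2, mem_range.2 (by omega), hb⟩, hbx⟩
  have hBN : B.Nonempty := (hcovB (Classical.arbitrary X)).imp fun _ h => h.1
  have hfr2 : ∀ x, f x ≤ r 2 := fun x => (infDist_le_iff hBN).2 (hcovB x)
  have hnr : Fintype.card X * r J ^ z ≤ R ^ z := card_mul_scale_pow_le hR.le hz
  -- The candidates are competitive, but there may be more than `k` of them.
  have hfsum : ∑ x, f x ^ z ≤ 3 * 4 ^ z * ∑ x, g x ^ z := by
    have h₁ : ∑ x, f x ^ z ≤ Fintype.card X * r J ^ z + ∑ j ∈ range J,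
        (2 * (#{x | r (j + 1) < 2 * g x} : ℝ)) * (r j ^ z - r (j + 1) ^ z) := by
      refine sum_pow_le_of_card_le hr0 hr2 hf0
        (fun x => (hfr2 x).trans (by linarith [hr2 0, hr2 1, hr0 2])) fun j hj => ?_
      have h₂ : #{x | r (j + 1) < f x} ≤ #{x | ∀ b ∈ G (j + 1), r (j + 1) < dist b x} := by
        refine card_le_card fun x hx => ?_
        simp only [mem_filter, mem_univ, true_and] at hx ⊢
        intro b hb
        exact (lt_infDist_iff hBN).1 hx b (mem_biUnion.2 ⟨j + 1, mem_range.2 (by omega), hb⟩)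
      have h₃ : #{x | ∀ o ∈ O, r (j + 1) / 2 < dist o x} ≤ #{x | r (j + 1) < 2 * g x} := by
        refine card_le_card fun x hx => ?_
        simp only [mem_filter, mem_univ, true_and] at hx ⊢
        have := (lt_infDist_iff hON).2 hx
        linarith
      have h₄ := h₂.trans ((hG (j + 1) (by omega)).trans (Nat.mul_le_mul_left 2 h₃))
      exact_mod_cast h₄
    have h₂ : ∑ j ∈ range J, (2 * (#{x | r (j + 1) < 2 * g x} : ℝ)) *
        (r j ^ z - r (j + 1) ^ z) ≤ 2 * ∑ x, (2 * (2 * g x)) ^ z := by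
      have := layer_sum_card_le (z := z) hr0 hr2 (f := fun x => 2 * g x)
        (fun x => by linarith [hg0 x]) J
      refine le_trans (le_of_eq ?_) (mul_le_mul_of_nonneg_left this zero_le_two)
      rw [mul_sum]
      exact sum_congr rfl fun j _ => by ring
    have h₃ : ∑ x, (2 * (2 * g x)) ^ z = 4 ^ z * ∑ x, g x ^ z := by
      rw [mul_sum]
      exact sum_congr rfl fun x _ => by rw [← mul_pow]; ring
    have h₄ : (2 : ℝ) ^ z * ∑ x, g x ^ z ≤ 4 ^ z * ∑ x, g x ^ z := by
      have := sum_nonneg fun x (_ : x ∈ univ) => pow_nonneg (hg0 x) z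
      gcongr
      norm_num
    linarith
  obtain ⟨C', hC'k, hC'⟩ := exists_snap hON hBN hO.1
  have hC'cov : ∀ x, ∃ c ∈ C', x ∈ near (c, 0) := by
    intro x
    obtain ⟨b, hb, hbB, hbx⟩ := hC' x
    refine ⟨b, hb, (hnear b hbB 0 (by omega) x).2 (hbx.trans ?_)⟩
    have h₁ := hgr3 x
    have h₂ := hfr2 x
    simp only [hg, hf] at h₁ h₂
    linarith [hr2 0, hr2 1, hr2 2, hr0 2]
  refine ⟨?_, fun C hC => ?_⟩
  · obtain ⟨C, hC, hmin⟩ := exists_min_image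
      (univ.filter fun C : Finset X => #C = k ∧ ∀ x, ∃ c ∈ C, x ∈ near (c, 0))
      (layerScore r J z near) ⟨C', mem_filter.2 ⟨mem_univ C', hC'k, hC'cov⟩⟩
    simp only [mem_filter, mem_univ, true_and] at hC hmin
    exact ⟨C, hC.1, hC.2, fun C'' h h' => hmin C'' ⟨h, h'⟩⟩
  obtain ⟨hCk, hCcov, hCmin⟩ := hC
  have hCN : C.Nonempty := card_pos.1 (by omega)
  have hknown : ∀ c j x, j < levels X → x ∈ near (c, j) → dist c x ≤ r j := by
    intro c j x hj hx
    by_cases hc : c ∈ B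
    · exact (hnear c hc j hj x).1 hx
    · rw [hnear' c hc] at hx
      exact absurd hx (notMem_empty x)
  have hup : ∑ x, Metric.infDist x (C : Set X) ^ z ≤
      Fintype.card X * r J ^ z + layerScore r J z near C := by
    refine sum_pow_le_of_card_le hr0 hr2 (fun x => Metric.infDist_nonneg) (fun x => ?_)
      fun j hj => ?_
    · obtain ⟨c, hc, hx⟩ := hCcov x
      exact (infDist_le_iff hCN).2 ⟨c, hc, hknown c 0 x (by omega) hx⟩
    · have : #{x | r (j + 1) < Metric.infDist x (C : Set X)} ≤
          #{x | ∀ c ∈ C, x ∉ near (c, j + 1)} := by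
        refine card_le_card fun x hx => ?_
        simp only [mem_filter, mem_univ, true_and] at hx ⊢
        intro c hc hxc
        exact ((lt_infDist_iff hCN).1 hx c hc).not_ge (hknown c _ x (by omega) hxc)
      exact_mod_cast this
  have hlow : layerScore r J z near C' ≤ ∑ x, (2 * (2 * g x + f x)) ^ z := by
    refine le_trans (sum_le_sum fun j hj => ?_) (layer_sum_card_le (z := z) hr0 hr2
      (f := fun x => 2 * g x + f x) (fun x => by linarith [hg0 x, hf0 x]) J)
    refine mul_le_mul_of_nonneg_right ?_ (layer_weight_nonneg hr0 hr2 j)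
    have : #{x | ∀ c ∈ C', x ∉ near (c, j + 1)} ≤ #{x | r (j + 1) < 2 * g x + f x} := by
      refine card_le_card fun x hx => ?_
      simp only [mem_filter, mem_univ, true_and] at hx ⊢
      obtain ⟨b, hb, hbB, hbx⟩ := hC' x
      have h := hx b hb
      rw [hnear b hbB _ (by have := mem_range.1 hj; omega), not_le] at h
      exact h.trans_le hbx
    exact_mod_cast this
  have hsplit : ∑ x, (2 * (2 * g x + f x)) ^ z ≤
      8 ^ z * ∑ x, g x ^ z + 4 ^ z * ∑ x, f x ^ z := by
    rw [mul_sum, mul_sum, ← sum_add_distrib]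
    refine sum_le_sum fun x _ => ?_
    have h₁ : (2 * g x + f x) ^ z ≤ 2 ^ z * ((2 * g x) ^ z + f x ^ z) := by
      refine (add_pow_le (by linarith [hg0 x]) (hf0 x) z).trans ?_
      have := pow_nonneg (hg0 x) z
      have := pow_nonneg (hf0 x) z
      rw [mul_pow]
      gcongr
      · norm_num
      · omega
    calc (2 * (2 * g x + f x)) ^ z = 2 ^ z * (2 * g x + f x) ^ z := mul_pow _ _ _
      _ ≤ 2 ^ z * (2 ^ z * ((2 * g x) ^ z + f x ^ z)) := by gcongr
      _ = 2 ^ z * 2 ^ z * 2 ^ z * g x ^ z + 2 ^ z * 2 ^ z * f x ^ z := by rw [mul_pow]; ring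
      _ = 8 ^ z * g x ^ z + 4 ^ z * f x ^ z := by
        rw [← mul_pow, ← mul_pow]
        norm_num
  refine cost_le_of_sum_le hz (by norm_num) ?_
  have hscore := hCmin C' hC'k hC'cov
  have hg_sum : 0 ≤ ∑ x, g x ^ z := sum_nonneg fun x _ => pow_nonneg (hg0 x) z
  have h₁ : (4 : ℝ) ^ z * ∑ x, f x ^ z ≤ 3 * 16 ^ z * ∑ x, g x ^ z := by
    calc (4 : ℝ) ^ z * ∑ x, f x ^ z ≤ 4 ^ z * (3 * 4 ^ z * ∑ x, g x ^ z) := by gcongr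
      _ = 3 * (4 ^ z * 4 ^ z) * ∑ x, g x ^ z := by ring
      _ = 3 * 16 ^ z * ∑ x, g x ^ z := by rw [← mul_pow]; norm_num
  have h₂ : (2 : ℝ) ^ z ≤ 16 ^ z := pow_le_pow_left₀ (by norm_num) (by norm_num) z
  have h₃ : (8 : ℝ) ^ z ≤ 16 ^ z := pow_le_pow_left₀ (by norm_num) (by norm_num) z
  have h₄ : 5 * (16 : ℝ) ^ z ≤ 80 ^ z := by
    have : (5 : ℝ) ≤ 5 ^ z := le_self_pow₀ (by norm_num) (by omega)
    calc 5 * (16 : ℝ) ^ z ≤ 5 ^ z * 16 ^ z := by gcongr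
      _ = 80 ^ z := by rw [← mul_pow]; norm_num
  calc ∑ x, Metric.infDist x (C : Set X) ^ z
      ≤ 2 ^ z * ∑ x, g x ^ z + (8 ^ z * ∑ x, g x ^ z + 3 * 16 ^ z * ∑ x, g x ^ z) := by linarith
    _ = (2 ^ z + 8 ^ z + 3 * 16 ^ z) * ∑ x, g x ^ z := by ring
    _ ≤ 80 ^ z * ∑ x, g x ^ z := by
        gcongr
        linarith

theorem exists_isOptimal {k : ℕ} (hk : k ≤ Fintype.card X) (z : ℕ) :
    ∃ O : Finset X, IsOptimal k z O := by
  obtain ⟨C, -, hC⟩ := exists_subset_card_eq (s := (univ : Finset X)) (by simpa using hk)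
  obtain ⟨O, hO, hmin⟩ := exists_min_image (powersetCard k (univ : Finset X)) (cost z)
    ⟨C, by simp [hC]⟩
  simp only [mem_powersetCard, subset_univ, true_and] at hO hmin
  exact ⟨O, hO, hmin⟩

theorem ensures_clusterTree [Nonempty X] (hP : P.Consistent) {k z : ℕ} (hk : 1 ≤ k)
    (hkX : k < Fintype.card X) (hz : 1 ≤ z) :
    Ensures dist (clusterTree k z P)
      (k * k + levels X * (logSize X * (2 * k * (2 * logSize X) * logSize X)) +
        levels X * (logSize X * (2 * k * (2 * logSize X))) * levels X * logSize X)
      (fun C => #C = k ∧ ∀ O : Finset X, IsOptimal k z O → cost z C ≤ 80 * cost z O) := by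
  rw [Nat.add_assoc]
  refine (ensures_scaleQuery hP hk hkX).bind fun R hR => ?_
  obtain ⟨hR0, ⟨C₀, hC₀, hcov⟩, hfar⟩ := hR
  refine ((ensures_tabulate fun j _ => ensures_cover hP hk (scale X R j)).mono
    (by rw [card_range]) fun _ h => h).bind fun G hG => ?_
  have hcard : #((range (levels X)).biUnion G ×ˢ range (levels X)) ≤
      levels X * (logSize X * (2 * k * (2 * logSize X))) * levels X := by
    rw [card_product, card_range]
    refine Nat.mul_le_mul_right _ ?_
    simpa using card_biUnion_le_card_mul (range (levels X)) G _ fun j hj => (hG.1 j hj).1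
  refine ((ensures_tabulate fun p _ => ensures_ballQuery hP p.1 (scale X R p.2)).bind (q' := 0)
    fun near hnear => ensures_output ?_).mono (Nat.mul_le_mul_right _ hcard) fun _ h => h
  have key := fun O (hO : IsOptimal k z O) => isBest_spec hk hz hR0 hC₀ hcov hO (hfar O hO.1)
    (fun j hj => (hG.1 j (mem_range.2 hj)).2 O hO.1)
    (near := near) (fun b hb j hj => hnear.1 (b, j) (mem_product.2 ⟨hb, mem_range.2 hj⟩))
    fun b hb j => hnear.2 (b, j) fun h => hb (mem_product.1 h).1
  obtain ⟨O, hO⟩ := exists_isOptimal hkX.le z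
  have hbest := Classical.epsilon_spec (key O hO).1
  exact ⟨hbest.1, fun O hO => (key O hO).2 _ hbest⟩

theorem expectedCost_pure (z : ℕ) (C : Finset X) : expectedCost z (PMF.pure C) = cost z C := by
  rw [expectedCost, sum_eq_single C]
  · simp
  · intro C' _ h
    simp [h]
  · simp

end Algorithm

end OrdinalClustering

theorem mainTheorem2 :
    ∃ (D K : ℝ) (A : OrdinalClustering.ClusteringAlgorithm.{u}),
      ∀ (X : Type u) [Fintype X] [MetricSpace X] (k z : ℕ),
        1 ≤ k → k ≤ Fintype.card X → 1 ≤ z →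
        ∀ P : OrdinalClustering.Profile X, P.Consistent →
          (∀ C ∈ ((A X k z P).result dist).support, C.card = k) ∧
          ((A X k z P).queries dist : ℝ) ≤
            K * (k : ℝ) ^ 4 * Real.log (Fintype.card X : ℝ) ^ 5 ∧
          ∀ Copt : Finset X, OrdinalClustering.IsOptimal k z Copt →
            OrdinalClustering.expectedCost z ((A X k z P).result dist) ≤
              D * OrdinalClustering.cost z Copt := by
  -- `80 = 5 * 16` collects the constants of the layer-cake bounds, and `3` is a bound for
  -- `logSize X / log |X|`.
  refine ⟨80, 81 * 3 ^ 5, OrdinalClustering.clusterAlgorithm, ?_⟩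
  intro X _ _ k z hk hkX hz P hP
  by_cases h : k < Fintype.card X
  · have : Nonempty X := Fintype.card_pos_iff.1 (by omega)
    obtain ⟨C, m, hrun, hm, hC, hcost⟩ := OrdinalClustering.ensures_clusterTree hP hk h hz
    have halg : OrdinalClustering.clusterAlgorithm X k z P =
        OrdinalClustering.clusterTree k z P := dif_pos h
    rw [halg, hrun.result_eq, hrun.queries_eq, OrdinalClustering.expectedCost_pure]
    refine ⟨by simpa using hC, ?_, hcost⟩
    exact (Nat.cast_le.2 hm).trans (OrdinalClustering.query_bound hk h)
  · have halg : OrdinalClustering.clusterAlgorithm X k z P =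
        OrdinalClustering.QueryTree.output Finset.univ := dif_neg h
    have hcard : Fintype.card X = k := by omega
    rw [halg, (OrdinalClustering.QueryTree.Runs.output _).result_eq,
      (OrdinalClustering.QueryTree.Runs.output _).queries_eq,
      OrdinalClustering.expectedCost_pure]
    refine ⟨by simpa using hcard, ?_, fun O hO => ?_⟩
    · have : (0 : ℝ) ≤ Real.log (Fintype.card X) := Real.log_natCast_nonneg _
      rw [Nat.cast_zero]
      positivity
    · rw [(Finset.card_eq_iff_eq_univ O).1 (hO.1.trans hcard.symm)]
      refine OrdinalClustering.cost_le_of_sum_le hz (by norm_num) ?_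
      refine le_mul_of_one_le_left ?_ (one_le_pow₀ (by norm_num))
      exact Finset.sum_nonneg fun x _ => pow_nonneg Metric.infDist_nonneg z
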